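/- Let $R_0>0$ be a constant and let $X_1,X_2,\dots$ be independent random variables with law $\mathcal N(0,1)$ (the null hypothesis). For $0\le a\le 1$, $b\in\mathbb R$, $c>0$ let $$p(x\mid a,b,c)=(1-a)\,\mathcal N(0,1)(x)+a\,\mathcal N(b,1/c)(x)$$ be the normal mixture density. The null hypothesis is the prior $\varphi_0=\delta_{(0,0,1)}$ on $(a,b,c)$. The alternative hypothesis is the prior $\varphi_1=\varphi_1^{(n)}$ under which $a$ is uniform on $(0,1)$ and, independently, $(b,c)$ is uniform on the ellipse $\{(b,c): b^2+(c-1)^2/2\le R_0^2/n\}$. Let $$L(X^n)=\frac{\int \prod_{i=1}^n p(X_i\mid w)\,d\varphi_1(w)}{\int \prod_{i=1}^n p(X_i\mid w)\,d\varphi_0(w)}$$ be the marginal likelihood ratio, and put $$\xi_n=\frac1{\sqrt n}\sum_{i=1}^nX_i,\qquad \eta_n=\frac1{\sqrt{2n}}\sum_{i=1}^n(X_i^2-1),\qquad \Xi_n=\sqrt{\xi_n^2+\eta_n^2}.$$ Then, as $n\to\infty$, $$L(X^n)-L_\infty(\Xi_n)\to 0\quad\text{in probability},$$ where $$L_\infty(\Xi)=\frac1{R_0^2}\int_0^{R_0^2}\Big(\frac{R_0}{\sqrt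 t}-1\Big)e^{-t/2}\,I_0(\sqrt t\,\Xi)\,dt,\qquad I_0(t)=\frac1\pi\int_0^\pi\cosh(t\sin\theta)\,d\theta,$$ and the modified Bessel function $I_0$ is strictly increasing on $t>0$. -/

import Mathlib

open MeasureTheory ProbabilityTheory Filter

noncomputable section

namespace HomogeneityTest

/-- The normal mixture density `p(x | a, b, c) = (1 - a) N(0, 1) + a N(b, 1/c)` at the point `x`,
for a parameter `w = (a, b, c)`, where `c > 0` is the precision of the mixed component. -/
def mixtureDensity (w : ℝ × ℝ × ℝ) (x : ℝ) : ℝ :=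
  (1 - w.1) * gaussianPDFReal 0 1 x + w.1 * gaussianPDFReal w.2.1 (1 / w.2.2).toNNReal x

/-- The likelihood of the parameter `w` for a sample of size `n`. -/
def likelihood {n : ℕ} (w : ℝ × ℝ × ℝ) (x : Fin n → ℝ) : ℝ :=
  ∏ i, mixtureDensity w (x i)

/-- The prior of the null hypothesis: the point mass at `(a, b, c) = (0, 0, 1)`. -/
def nullPrior : Measure (ℝ × ℝ × ℝ) := Measure.dirac (0, 0, 1)

/-- The ellipse `b² + (c - 1)² / 2 ≤ R₀² / n` in the `(b, c)` plane. -/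
def ellipse (R₀ : ℝ) (n : ℕ) : Set (ℝ × ℝ) :=
  {q | q.1 ^ 2 + (q.2 - 1) ^ 2 / 2 ≤ R₀ ^ 2 / n}

/-- The prior of the alternative hypothesis: `a` uniform on `(0, 1)` and, independently,
`(b, c)` uniform on the ellipse. (`cond volume s` is the uniform distribution on `s`.) -/
def altPrior (R₀ : ℝ) (n : ℕ) : Measure (ℝ × ℝ × ℝ) :=
  (cond volume (Set.Ioo (0 : ℝ) 1)).prod (cond volume (ellipse R₀ n))

/-- The marginal likelihood ratio of the prior `φ₁` against the prior `φ₀` for the sample `x`. -/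
def marginalLikelihoodRatio (φ₁ φ₀ : Measure (ℝ × ℝ × ℝ)) {n : ℕ} (x : Fin n → ℝ) : ℝ :=
  (∫ w, likelihood w x ∂φ₁) / (∫ w, likelihood w x ∂φ₀)

/-- `ξ_n = n^{-1/2} ∑ X_i`. -/
def xiStat {n : ℕ} (x : Fin n → ℝ) : ℝ := (1 / √(n : ℝ)) * ∑ i, x i

/-- `η_n = (2n)^{-1/2} ∑ (X_i² - 1)`. -/
def etaStat {n : ℕ} (x : Fin n → ℝ) : ℝ := (1 / √(2 * (n : ℝ))) * ∑ i, (x i ^ 2 - 1)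

/-- `Ξ_n = √(ξ_n² + η_n²)`. -/
def XiStat {n : ℕ} (x : Fin n → ℝ) : ℝ := √(xiStat x ^ 2 + etaStat x ^ 2)

/-- The modified Bessel function `I₀`. -/
def besselI0 (t : ℝ) : ℝ :=
  (1 / Real.pi) * ∫ θ in (0 : ℝ)..Real.pi, Real.cosh (t * Real.sin θ)

/-- The limit function `L_∞`. -/
def limitRatio (R₀ : ℝ) (z : ℝ) : ℝ :=
  (1 / R₀ ^ 2) * ∫ t in (0 : ℝ)..R₀ ^ 2,
    (R₀ / √t - 1) * Real.exp (-t / 2) * besselI0 (√t * z)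

end HomogeneityTest

end

/-!
After the rescaling `b = u / √n`, `c = 1 + √2 v / √n`, the alternative prior becomes a fixed law:
`a` uniform on `(0, 1)` and `(u, v)` uniform on the disc of radius `R₀`. At a local parameter
`(a, u, v)` the likelihood ratio `Z` of the sample is a product of terms `1 - a + a g(Xᵢ)`, with `g`
the density ratio of `N(b, 1/c)` against `N(0, 1)`, and it is compared with the likelihood ratio of a
Gaussian shift experiment, `W = exp (a (u ξ - v η) - a² (u² + v²) / 2)`.

* The average of `W` over the rescaled prior is exactly `limitRatio R₀ Ξ`
  (`integral_discPrior_exp`): polar coordinates produce the Bessel function of `a r Ξ`, and an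
  integration by parts in `a` and `r` followed by `t = s²` gives the stated integral.
* The mean square `E[(Z - W)²]` under the null hypothesis is `Aⁿ - 2 Bⁿ + Cⁿ`, where `A`, `B`, `C`
  are combinations of one-dimensional Gaussian integrals of exponentials of quadratic polynomials,
  known in closed form (`integral_exp_quadratic`). A second-order expansion in `ε = 1 / √n`
  (`mixedMoment_sub_isLittleO`) shows that all three are `1 + a² (u² + v²) / n + o(1 / n)`, so that
  their powers share one limit and the mean square tends to `0`, uniformly in the local parameter
  (`eventually_forall_secondMoment_lt`).
* By Tonelli's theorem the average of `|Z - W|` over the prior tends to `0` in mean, and Markov's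
  inequality gives convergence in probability (`nullSample_le_of_secondMoment`).

The Bessel function increases strictly because each `cosh (t sin θ)` with `sin θ > 0` does.
-/

open Asymptotics Topology

noncomputable section

namespace HomogeneityTest

/-! ### The Bessel function -/

theorem continuous_besselI0 : Continuous besselI0 := by
  unfold besselI0
  refine continuous_const.mul ?_
  exact intervalIntegral.continuous_parametric_intervalIntegral_of_continuous' (by fun_prop) _ _

theorem besselI0_zero : besselI0 0 = 1 := by
  simp [besselI0, Real.pi_ne_zero]

theorem strictMonoOn_besselI0 : StrictMonoOn besselI0 (Set.Ioi 0) := by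
  intro s hs t ht hst
  have hs : 0 < s := hs
  have hpi := Real.pi_pos
  unfold besselI0
  refine mul_lt_mul_of_pos_left ?_ (by positivity)
  have key : ∀ θ, 0 ≤ Real.sin θ → |s * Real.sin θ| ≤ |t * Real.sin θ| := by
    intro θ hθ
    rw [abs_of_nonneg (by positivity), abs_of_nonneg (by nlinarith)]
    nlinarith
  refine intervalIntegral.integral_lt_integral_of_continuousOn_of_le_of_exists_lt hpi
    (by fun_prop) (by fun_prop) ?_ ⟨Real.pi / 2, ⟨by linarith, by linarith⟩, ?_⟩
  · intro θ hθ
    exact Real.cosh_le_cosh.2 (key θ (Real.sin_nonneg_of_nonneg_of_le_pi hθ.1.le hθ.2))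
  · simp only [Real.sin_pi_div_two, mul_one]
    apply Real.cosh_lt_cosh.2
    rwa [abs_of_pos hs, abs_of_pos (hs.trans hst)]

/-- Over a full period only the amplitude of `ξ cos θ - η sin θ` matters, and folding the sine wave
`√(ξ² + η²) sin` onto a half period turns the exponential into a hyperbolic cosine. -/
theorem integral_exp_cos_sub_sin (r ξ η : ℝ) :
    ∫ θ in (-Real.pi)..Real.pi, Real.exp (r * Real.cos θ * ξ - r * Real.sin θ * η)
      = 2 * Real.pi * besselI0 (r * √(ξ ^ 2 + η ^ 2)) := by
  obtain ⟨φ, h1, h2⟩ : ∃ φ : ℝ, ξ = √(ξ ^ 2 + η ^ 2) * Real.sin φ ∧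
      -η = √(ξ ^ 2 + η ^ 2) * Real.cos φ := by
    refine ⟨Complex.arg ⟨-η, ξ⟩, ?_, ?_⟩
    · have := Complex.norm_mul_sin_arg ⟨-η, ξ⟩
      rw [Complex.norm_def, Complex.normSq_mk] at this
      rw [show ξ ^ 2 + η ^ 2 = -η * -η + ξ * ξ by ring]
      exact this.symm
    · have := Complex.norm_mul_cos_arg ⟨-η, ξ⟩
      rw [Complex.norm_def, Complex.normSq_mk] at this
      rw [show ξ ^ 2 + η ^ 2 = -η * -η + ξ * ξ by ring]
      exact this.symm
  set A := √(ξ ^ 2 + η ^ 2)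
  set z := r * A
  have e1 : ∀ θ, r * Real.cos θ * ξ - r * Real.sin θ * η = z * Real.sin (θ + φ) := by
    intro θ
    rw [Real.sin_add]
    linear_combination r * Real.cos θ * h1 + r * Real.sin θ * h2
  simp_rw [e1]
  have hper : Function.Periodic (fun θ => Real.exp (z * Real.sin θ)) (2 * Real.pi) := by
    intro θ; simp
  rw [intervalIntegral.integral_comp_add_right (fun θ => Real.exp (z * Real.sin θ))]
  have e2 := hper.intervalIntegral_add_eq (-Real.pi + φ) (-Real.pi)
  rw [show -Real.pi + φ + 2 * Real.pi = Real.pi + φ by ring,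
    show -Real.pi + 2 * Real.pi = Real.pi by ring] at e2
  have hc : Continuous fun θ => Real.exp (z * Real.sin θ) := by fun_prop
  have hc' : Continuous fun θ => Real.exp (-(z * Real.sin θ)) := by fun_prop
  rw [e2, ← intervalIntegral.integral_add_adjacent_intervals
    (hc.intervalIntegrable (-Real.pi) 0) (hc.intervalIntegrable 0 Real.pi)]
  have e3 : ∫ θ in (-Real.pi)..0, Real.exp (z * Real.sin θ)
      = ∫ θ in (0 : ℝ)..Real.pi, Real.exp (-(z * Real.sin θ)) := by
    have := intervalIntegral.integral_comp_neg (a := 0) (b := Real.pi)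
      (fun θ => Real.exp (z * Real.sin θ))
    simp only [Real.sin_neg, mul_neg, neg_zero] at this
    exact this.symm
  rw [e3, ← intervalIntegral.integral_add (hc'.intervalIntegrable _ _) (hc.intervalIntegrable _ _)]
  unfold besselI0
  simp_rw [Real.cosh_eq]
  rw [intervalIntegral.integral_div]
  have : ∀ θ, Real.exp (-(z * Real.sin θ)) + Real.exp (z * Real.sin θ)
    = Real.exp (z * Real.sin θ) + Real.exp (-(z * Real.sin θ)) := fun θ => add_comm _ _
  simp_rw [this]
  field_simp [Real.pi_ne_zero]

/-! ### Integration over the disc in polar coordinates -/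

/-- The closed disc of radius `R` in the plane. -/
def disc (R : ℝ) : Set (ℝ × ℝ) := {q | q.1 ^ 2 + q.2 ^ 2 ≤ R ^ 2}

theorem measurableSet_disc (R : ℝ) : MeasurableSet (disc R) :=
  measurableSet_le (by fun_prop) (by fun_prop)

theorem setIntegral_disc_eq_polar {R : ℝ} (hR : 0 < R) {F : ℝ × ℝ → ℝ} (hF : Continuous F) :
    ∫ q in disc R, F q
      = ∫ r in (0 : ℝ)..R, r * ∫ θ in (-Real.pi)..Real.pi, F (r * Real.cos θ, r * Real.sin θ) := by
  have hpi := Real.pi_pos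
  rw [← integral_indicator (measurableSet_disc R), ← integral_comp_polarCoord_symm,
    polarCoord_target]
  have e1 : ∀ p ∈ Set.Ioi (0 : ℝ) ×ˢ Set.Ioo (-Real.pi) Real.pi,
      p.1 • (disc R).indicator F (polarCoord.symm p)
        = (Set.Iic R ×ˢ Set.univ).indicator
            (fun p : ℝ × ℝ => p.1 * F (p.1 * Real.cos p.2, p.1 * Real.sin p.2)) p := by
    rintro ⟨r, θ⟩ ⟨hr, -⟩
    have hr : 0 < r := hr
    have : (r * Real.cos θ, r * Real.sin θ) ∈ disc R ↔ r ≤ R := by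
      have h : (r * Real.cos θ) ^ 2 + (r * Real.sin θ) ^ 2 = r ^ 2 := by
        linear_combination r ^ 2 * Real.sin_sq_add_cos_sq θ
      simp only [disc, Set.mem_ofPred_eq, h]
      exact pow_le_pow_iff_left₀ hr.le hR.le two_ne_zero
    by_cases h : r ≤ R
    · simp [polarCoord_symm_apply, Set.indicator, this, h]
    · simp [polarCoord_symm_apply, Set.indicator, this, h]
  rw [setIntegral_congr_fun (by measurability) e1, setIntegral_indicator (by measurability),
    Set.prod_inter_prod, Set.inter_univ, Set.Ioi_inter_Iic, Measure.volume_eq_prod,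
    setIntegral_prod]
  · rw [intervalIntegral.integral_of_le hR.le]
    refine setIntegral_congr_fun measurableSet_Ioc fun r _ => ?_
    simp only
    rw [intervalIntegral.integral_of_le (by linarith), integral_Ioc_eq_integral_Ioo,
      integral_const_mul]
  · have : IntegrableOn (fun p : ℝ × ℝ => p.1 * F (p.1 * Real.cos p.2, p.1 * Real.sin p.2))
        (Set.Icc 0 R ×ˢ Set.Icc (-Real.pi) Real.pi) (volume.prod volume) :=
      ContinuousOn.integrableOn_compact (isCompact_Icc.prod isCompact_Icc)
        (Continuous.continuousOn (by fun_prop))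
    exact this.mono_set (Set.prod_mono Set.Ioc_subset_Icc_self Set.Ioo_subset_Icc_self)

theorem setIntegral_disc_exp {R : ℝ} (hR : 0 < R) (a ξ η : ℝ) :
    ∫ q in disc R, Real.exp (a * (q.1 * ξ - q.2 * η) - a ^ 2 * (q.1 ^ 2 + q.2 ^ 2) / 2)
      = 2 * Real.pi * ∫ r in (0 : ℝ)..R,
          r * (Real.exp (-(a * r) ^ 2 / 2) * besselI0 (a * r * √(ξ ^ 2 + η ^ 2))) := by
  rw [setIntegral_disc_eq_polar hR (by fun_prop), ← intervalIntegral.integral_const_mul]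
  refine intervalIntegral.integral_congr fun r _ => ?_
  have : ∀ θ, Real.exp (a * (r * Real.cos θ * ξ - r * Real.sin θ * η)
      - a ^ 2 * ((r * Real.cos θ) ^ 2 + (r * Real.sin θ) ^ 2) / 2)
      = Real.exp (-(a * r) ^ 2 / 2)
        * Real.exp (a * r * Real.cos θ * ξ - a * r * Real.sin θ * η) := by
    intro θ
    rw [← Real.exp_add]
    congr 1
    linear_combination (- a ^ 2 * r ^ 2 / 2) * Real.sin_sq_add_cos_sq θ
  simp only [this]
  rw [intervalIntegral.integral_const_mul, integral_exp_cos_sub_sin]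
  ring

theorem volume_real_disc {R : ℝ} (hR : 0 < R) : volume.real (disc R) = Real.pi * R ^ 2 := by
  have := setIntegral_disc_exp hR 0 0 0
  simp [besselI0_zero] at this
  rw [this]; ring

theorem volume_disc_ne_zero {R : ℝ} (hR : 0 < R) : volume (disc R) ≠ 0 := by
  intro h
  have := volume_real_disc hR
  rw [Measure.real, h] at this
  have : 0 < Real.pi * R ^ 2 := by positivity
  simp_all

theorem volume_disc_ne_top {R : ℝ} (hR : 0 < R) : volume (disc R) ≠ ⊤ := by
  intro h
  have := volume_real_disc hR
  rw [Measure.real, h] at this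
  have : 0 < Real.pi * R ^ 2 := by positivity
  simp_all

/-- Integrating over `a` first: `r ∫₀¹ H(ar) da` is the primitive of `H`, and a second integration
by parts leaves the triangular weight `R - s`. -/
theorem integral_integral_mul_comp_mul {R : ℝ} (hR : 0 < R) {H : ℝ → ℝ} (hH : Continuous H) :
    ∫ a in (0 : ℝ)..1, ∫ r in (0 : ℝ)..R, r * H (a * r) = ∫ s in (0 : ℝ)..R, (R - s) * H s := by
  -- Interchanging the integrals makes the inner one, in `a`, a primitive of `H`.
  have hswap : ∫ a in (0 : ℝ)..1, ∫ r in (0 : ℝ)..R, r * H (a * r)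
      = ∫ r in (0 : ℝ)..R, ∫ a in (0 : ℝ)..1, r * H (a * r) := by
    simp_rw [intervalIntegral.integral_of_le hR.le, intervalIntegral.integral_of_le zero_le_one]
    apply integral_integral_swap
    have : IntegrableOn (fun p : ℝ × ℝ => p.2 * H (p.1 * p.2))
        (Set.Icc 0 1 ×ˢ Set.Icc 0 R) (volume.prod volume) :=
      ContinuousOn.integrableOn_compact (isCompact_Icc.prod isCompact_Icc)
        (Continuous.continuousOn (by fun_prop))
    have h := this.mono_set (Set.prod_mono Set.Ioc_subset_Icc_self Set.Ioc_subset_Icc_self)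
    rw [IntegrableOn, ← Measure.prod_restrict] at h
    exact h
  rw [hswap]
  have e1 : ∀ r, ∫ a in (0 : ℝ)..1, r * H (a * r) = ∫ s in (0 : ℝ)..r, H s := by
    intro r
    rw [intervalIntegral.integral_const_mul, ← smul_eq_mul,
      intervalIntegral.smul_integral_comp_mul_right]
    simp
  simp_rw [e1]
  have h1 : ∀ x ∈ Set.uIcc 0 R, HasDerivAt (fun r => ∫ s in (0 : ℝ)..r, H s) (H x) x :=
    fun x _ => intervalIntegral.integral_hasDerivAt_right (hH.intervalIntegrable _ _)
      (hH.stronglyMeasurableAtFilter _ _) hH.continuousAt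
  have h2 : ∀ x ∈ Set.uIcc 0 R, HasDerivAt (fun r => r - R) 1 x :=
    fun x _ => (hasDerivAt_id x).sub_const R
  have := intervalIntegral.integral_mul_deriv_eq_deriv_mul h1 h2 (hH.intervalIntegrable _ _)
    (by simp)
  simp only [mul_one, sub_self, mul_zero, intervalIntegral.integral_same, zero_mul, zero_sub]
    at this
  rw [this, ← intervalIntegral.integral_neg]
  exact intervalIntegral.integral_congr fun s _ => by ring

/-- The substitution `t = s²`. -/
theorem limitRatio_eq_integral_sub_mul {R : ℝ} (hR : 0 < R) (z : ℝ) :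
    limitRatio R z
      = 2 / R ^ 2 * ∫ s in (0 : ℝ)..R, (R - s) * (Real.exp (-s ^ 2 / 2) * besselI0 (s * z)) := by
  have himg : (fun s : ℝ => s ^ 2) '' Set.Ioo 0 R = Set.Ioo 0 (R ^ 2) := by
    ext t
    constructor
    · rintro ⟨s, ⟨h0, h1⟩, rfl⟩
      exact ⟨pow_pos h0 2, pow_lt_pow_left₀ h1 h0.le two_ne_zero⟩
    · rintro ⟨h0, h1⟩
      exact ⟨√t, ⟨Real.sqrt_pos.2 h0, (Real.sqrt_lt' hR).2 h1⟩, Real.sq_sqrt h0.le⟩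
  have hinj : Set.InjOn (fun s : ℝ => s ^ 2) (Set.Ioo 0 R) := by
    intro x hx y hy h
    exact (pow_left_inj₀ (M₀ := ℝ) hx.1.le hy.1.le two_ne_zero).1 h
  have hmain : ∫ t in Set.Ioo 0 (R ^ 2), (R / √t - 1) * Real.exp (-t / 2) * besselI0 (√t * z)
      = 2 * ∫ s in Set.Ioo 0 R, (R - s) * (Real.exp (-s ^ 2 / 2) * besselI0 (s * z)) := by
    rw [← himg, integral_image_eq_integral_abs_deriv_smul measurableSet_Ioo
      (fun x _ => (hasDerivAt_pow 2 x).hasDerivWithinAt) hinj, ← integral_const_mul]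
    refine setIntegral_congr_fun measurableSet_Ioo fun s hs => ?_
    have hs0 : 0 < s := hs.1
    simp only [smul_eq_mul, Real.sqrt_sq hs0.le]
    rw [abs_of_pos (by positivity)]
    push_cast
    field_simp
  rw [limitRatio, intervalIntegral.integral_of_le (by positivity),
    intervalIntegral.integral_of_le hR.le, integral_Ioc_eq_integral_Ioo,
    integral_Ioc_eq_integral_Ioo, hmain]
  ring

/-! ### The rescaled prior and the limiting ratio -/

/-- The fixed prior for the rescaled parameters `(a, u, v)`: `a` is uniform on `(0, 1)` and
`(u, v)` is uniform on the disc of radius `R`. -/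
def discPrior (R : ℝ) : Measure (ℝ × ℝ × ℝ) :=
  (cond volume (Set.Ioo (0 : ℝ) 1)).prod (cond volume (disc R))

theorem isProbabilityMeasure_discPrior {R : ℝ} (hR : 0 < R) :
    IsProbabilityMeasure (discPrior R) := by
  have := cond_isProbabilityMeasure_of_finite (volume_disc_ne_zero hR) (volume_disc_ne_top hR)
  have : IsProbabilityMeasure (cond volume (Set.Ioo (0 : ℝ) 1)) :=
    cond_isProbabilityMeasure_of_finite (by simp [Real.volume_Ioo]) (by simp [Real.volume_Ioo])
  unfold discPrior
  infer_instance

theorem discPrior_eq_smul_restrict (R : ℝ) :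
    discPrior R
      = (volume (disc R))⁻¹ • (volume.restrict (Set.Ioo 0 1)).prod (volume.restrict (disc R)) := by
  rw [discPrior, ProbabilityTheory.cond, ProbabilityTheory.cond, Measure.prod_smul_right]
  simp [Real.volume_Ioo]

theorem ae_discPrior_mem (R : ℝ) : ∀ᵐ w ∂discPrior R, w ∈ Set.Ioo (0 : ℝ) 1 ×ˢ disc R := by
  rw [discPrior_eq_smul_restrict, Measure.prod_restrict]
  exact Measure.ae_smul_measure
    (ae_restrict_mem (measurableSet_Ioo.prod (measurableSet_disc R))) _

theorem disc_subset {R : ℝ} (hR : 0 < R) : disc R ⊆ Set.Icc (-R) R ×ˢ Set.Icc (-R) R := by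
  rintro ⟨u, v⟩ h
  have h : u ^ 2 + v ^ 2 ≤ R ^ 2 := h
  exact ⟨abs_le.1 (abs_le_of_sq_le_sq (by nlinarith) hR.le),
    abs_le.1 (abs_le_of_sq_le_sq (by nlinarith) hR.le)⟩

theorem integrable_prod_disc_exp {R : ℝ} (hR : 0 < R) (ξ η : ℝ) :
    Integrable (fun w : ℝ × ℝ × ℝ =>
      Real.exp (w.1 * (w.2.1 * ξ - w.2.2 * η) - w.1 ^ 2 * (w.2.1 ^ 2 + w.2.2 ^ 2) / 2))
      ((volume.restrict (Set.Ioo 0 1)).prod (volume.restrict (disc R))) := by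
  rw [Measure.prod_restrict]
  have : IntegrableOn (fun w : ℝ × ℝ × ℝ =>
      Real.exp (w.1 * (w.2.1 * ξ - w.2.2 * η) - w.1 ^ 2 * (w.2.1 ^ 2 + w.2.2 ^ 2) / 2))
      (Set.Icc 0 1 ×ˢ (Set.Icc (-R) R ×ˢ Set.Icc (-R) R)) (volume.prod volume) :=
    ContinuousOn.integrableOn_compact
      (isCompact_Icc.prod (isCompact_Icc.prod isCompact_Icc))
      (Continuous.continuousOn (by fun_prop))
  exact this.mono_set (Set.prod_mono Set.Ioo_subset_Icc_self (disc_subset hR))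

theorem integrable_discPrior_exp {R : ℝ} (hR : 0 < R) (ξ η : ℝ) :
    Integrable (fun w : ℝ × ℝ × ℝ =>
      Real.exp (w.1 * (w.2.1 * ξ - w.2.2 * η) - w.1 ^ 2 * (w.2.1 ^ 2 + w.2.2 ^ 2) / 2))
      (discPrior R) := by
  rw [discPrior_eq_smul_restrict]
  exact (integrable_prod_disc_exp hR ξ η).smul_measure
    (ENNReal.inv_ne_top.2 (volume_disc_ne_zero hR))

/-- The limit experiment: the Gaussian-shift likelihood ratio with score `(ξ, -η)` averages over
the rescaled prior to the function `limitRatio` of the length of the score. -/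
theorem integral_discPrior_exp {R : ℝ} (hR : 0 < R) (ξ η : ℝ) :
    ∫ w, Real.exp (w.1 * (w.2.1 * ξ - w.2.2 * η) - w.1 ^ 2 * (w.2.1 ^ 2 + w.2.2 ^ 2) / 2)
        ∂discPrior R
      = limitRatio R √(ξ ^ 2 + η ^ 2) := by
  rw [discPrior_eq_smul_restrict, integral_smul_measure,
    integral_prod _ (integrable_prod_disc_exp hR ξ η), ENNReal.toReal_inv, ← Measure.real,
    volume_real_disc hR]
  simp only [setIntegral_disc_exp hR]
  have hH : Continuous fun s => Real.exp (-s ^ 2 / 2) * besselI0 (s * √(ξ ^ 2 + η ^ 2)) := by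
    have := continuous_besselI0
    fun_prop
  rw [integral_const_mul, ← integral_Ioc_eq_integral_Ioo,
    ← intervalIntegral.integral_of_le zero_le_one, integral_integral_mul_comp_mul hR hH,
    limitRatio_eq_integral_sub_mul hR, smul_eq_mul]
  have hconst : ∀ I : ℝ, (Real.pi * R ^ 2)⁻¹ * (2 * Real.pi * I) = 2 / R ^ 2 * I := by
    intro I
    field_simp
  exact hconst _

/-- The local parametrization `(a, u, v) ↦ (a, b, c) = (a, ε u, 1 + √2 ε v)` at scale `ε`. -/
def localParam (ε : ℝ) (w : ℝ × ℝ × ℝ) : ℝ × ℝ × ℝ := (w.1, ε * w.2.1, 1 + √2 * ε * w.2.2)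

theorem measurable_localParam (ε : ℝ) : Measurable (localParam ε) := by
  unfold localParam
  fun_prop

/-- A map under which Lebesgue measure is only scaled carries uniform laws to uniform laws. -/
theorem map_cond_preimage {α β : Type*} [MeasurableSpace α] [MeasurableSpace β] {μ : Measure α}
    {ν : Measure β} {f : α → β} (hf : Measurable f) {κ : ENNReal} (h0 : κ ≠ 0) (ht : κ ≠ ⊤)
    (h : μ.map f = κ • ν) {s : Set β} (hs : MeasurableSet s) :
    (ProbabilityTheory.cond μ (f ⁻¹' s)).map f = ProbabilityTheory.cond ν s := by
  have h1 : μ (f ⁻¹' s) = κ * ν s := by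
    rw [← Measure.map_apply hf hs, h]; rfl
  rw [ProbabilityTheory.cond, ProbabilityTheory.cond, Measure.map_smul,
    ← Measure.restrict_map hf hs, h, h1, Measure.restrict_smul, smul_smul,
    ENNReal.mul_inv (Or.inl h0) (Or.inl ht), mul_right_comm, ENNReal.inv_mul_cancel h0 ht, one_mul]

theorem map_add_mul_volume (d : ℝ) {k : ℝ} (hk : k ≠ 0) :
    (volume : Measure ℝ).map (fun x => d + k * x) = ENNReal.ofReal |k⁻¹| • volume := by
  have : (fun x => d + k * x) = (fun x => d + x) ∘ (fun x => k * x) := rfl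
  rw [this, ← Measure.map_map (by fun_prop) (by fun_prop), Real.map_volume_mul_left hk,
    Measure.map_smul, map_add_left_eq_self]

theorem measurableSet_ellipse (R : ℝ) (n : ℕ) : MeasurableSet (ellipse R n) :=
  measurableSet_le (by fun_prop) (by fun_prop)

theorem altPrior_eq_map_discPrior {R : ℝ} (hR : 0 < R) {n : ℕ} (hn : 0 < n) :
    altPrior R n = (discPrior R).map (localParam (1 / √n)) := by
  have hn' : (0 : ℝ) < n := by exact_mod_cast hn
  set ε := 1 / √(n : ℝ) with hε
  have hε0 : 0 < ε := by positivity
  have hε2 : ε ^ 2 = 1 / n := by rw [hε, div_pow, Real.sq_sqrt hn'.le, one_pow]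
  set f : ℝ × ℝ → ℝ × ℝ := Prod.map (fun u => 0 + ε * u) (fun v => 1 + √2 * ε * v)
  have hf : Measurable f := by fun_prop
  have hk : √2 * ε ≠ 0 := by positivity
  have hmap : (volume : Measure (ℝ × ℝ)).map f
      = (ENNReal.ofReal |ε⁻¹| * ENNReal.ofReal |(√2 * ε)⁻¹|) • volume := by
    rw [Measure.volume_eq_prod, ← Measure.map_prod_map _ _ (by fun_prop) (by fun_prop),
      map_add_mul_volume 0 hε0.ne', map_add_mul_volume 1 hk, Measure.prod_smul_left,
      Measure.prod_smul_right, smul_smul]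
  have hpre : f ⁻¹' ellipse R n = disc R := by
    ext ⟨u, v⟩
    have h2 : √(2 : ℝ) ^ 2 = 2 := Real.sq_sqrt (by norm_num)
    have : (0 + ε * u) ^ 2 + (1 + √2 * ε * v - 1) ^ 2 / 2 = ε ^ 2 * (u ^ 2 + v ^ 2) := by
      linear_combination ε ^ 2 * v ^ 2 / 2 * h2
    simp only [f, ellipse, disc, Set.mem_preimage, Set.mem_ofPred_eq, Prod.map, this, hε2]
    rw [one_div_mul_eq_div, div_le_div_iff_of_pos_right hn']
  have hcond := map_cond_preimage hf (by positivity)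
    (ENNReal.mul_ne_top ENNReal.ofReal_ne_top ENNReal.ofReal_ne_top) hmap
    (measurableSet_ellipse R n)
  rw [hpre] at hcond
  have := cond_isProbabilityMeasure_of_finite (volume_disc_ne_zero hR) (volume_disc_ne_top hR)
  have hl : localParam ε = Prod.map id f := by
    ext w <;> simp [localParam, f]
  rw [altPrior, ← hcond, hl, discPrior, ← Measure.map_prod_map _ _ measurable_id hf, Measure.map_id]

theorem integral_altPrior {R : ℝ} (hR : 0 < R) {n : ℕ} (hn : 0 < n) {F : ℝ × ℝ × ℝ → ℝ}
    (hF : Measurable F) :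
    ∫ w, F w ∂altPrior R n = ∫ w, F (localParam (1 / √n) w) ∂discPrior R := by
  rw [altPrior_eq_map_discPrior hR hn,
    integral_map (measurable_localParam _).aemeasurable hF.aestronglyMeasurable]

/-! ### Density ratios and Gaussian integrals -/

/-- The log-density ratio of `N(b, 1/c)` against `N(0, 1)` at the point `x`. -/
def logDensityRatio (b c x : ℝ) : ℝ :=
  Real.log c / 2 + c * b * x - c * b ^ 2 / 2 - (c - 1) * x ^ 2 / 2

theorem gaussianPDFReal_eq_mul_exp (b : ℝ) {c : ℝ} (hc : 0 < c) (x : ℝ) :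
    gaussianPDFReal b (1 / c).toNNReal x
      = gaussianPDFReal 0 1 x * Real.exp (logDensityRatio b c x) := by
  have hc' : ((1 / c).toNNReal : ℝ) = 1 / c := Real.coe_toNNReal _ (by positivity)
  have h1 : Real.exp (Real.log c / 2) = √c := by
    rw [Real.exp_half, Real.exp_log hc]
  have h2 : √(2 * Real.pi * (1 / c)) = √(2 * Real.pi) / √c := by
    rw [mul_one_div, Real.sqrt_div (by positivity)]
  have h3 : logDensityRatio b c x
      = Real.log c / 2 + (c * b * x - c * b ^ 2 / 2 - (c - 1) * x ^ 2 / 2) := by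
    rw [logDensityRatio]; ring
  have h4 : Real.exp (-(x - b) ^ 2 / (2 * (1 / c))) = Real.exp (-x ^ 2 / 2)
      * Real.exp (c * b * x - c * b ^ 2 / 2 - (c - 1) * x ^ 2 / 2) := by
    rw [← Real.exp_add]
    congr 1
    field_simp
    ring
  rw [gaussianPDFReal, gaussianPDFReal, hc', h2, h3, Real.exp_add, h1, h4]
  simp only [NNReal.coe_one, mul_one, sub_zero]
  rw [inv_div]
  ring

theorem gaussianPDFReal_mul_exp_quadratic (α γ : ℝ) {β : ℝ} (hβ : 0 < 1 - 2 * β) (x : ℝ) :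
    gaussianPDFReal 0 1 x * Real.exp (α * x + β * x ^ 2 + γ)
      = Real.exp (γ - Real.log (1 - 2 * β) / 2 + α ^ 2 / (2 * (1 - 2 * β)))
        * gaussianPDFReal (α / (1 - 2 * β)) (1 / (1 - 2 * β)).toNNReal x := by
  rw [gaussianPDFReal_eq_mul_exp _ hβ, mul_left_comm, ← Real.exp_add, logDensityRatio]
  congr 2
  obtain ⟨t, ht⟩ : ∃ t, 1 - 2 * β = t := ⟨_, rfl⟩
  obtain rfl : β = (1 - t) / 2 := by linarith
  rw [ht] at hβ ⊢
  field_simp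
  ring

theorem integrable_exp_quadratic (α γ : ℝ) {β : ℝ} (hβ : 0 < 1 - 2 * β) :
    Integrable (fun x => Real.exp (α * x + β * x ^ 2 + γ)) (gaussianReal 0 1) := by
  rw [gaussianReal_of_var_ne_zero _ one_ne_zero]
  unfold gaussianPDF
  rw [integrable_withDensity_iff_integrable_smul' (by fun_prop) (by simp)]
  simp only [smul_eq_mul, ENNReal.toReal_ofReal (gaussianPDFReal_nonneg _ _ _),
    gaussianPDFReal_mul_exp_quadratic α γ hβ]
  exact (integrable_gaussianPDFReal _ _).const_mul _

theorem integral_exp_quadratic (α γ : ℝ) {β : ℝ} (hβ : 0 < 1 - 2 * β) :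
    ∫ x, Real.exp (α * x + β * x ^ 2 + γ) ∂gaussianReal 0 1
      = Real.exp (γ - Real.log (1 - 2 * β) / 2 + α ^ 2 / (2 * (1 - 2 * β))) := by
  rw [integral_gaussianReal_eq_integral_smul one_ne_zero]
  simp only [smul_eq_mul, gaussianPDFReal_mul_exp_quadratic α γ hβ]
  rw [integral_const_mul, integral_gaussianPDFReal_eq_one, mul_one]
  rw [Ne, Real.toNNReal_eq_zero]
  push Not
  positivity

/-! ### Likelihood ratios at local parameters -/

/-- The contribution of one observation `x` to the log-likelihood ratio of the limiting
Gaussian shift experiment at the local parameter `w = (a, u, v)` and scale `ε`. -/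
def shiftLogRatio (ε : ℝ) (w : ℝ × ℝ × ℝ) (x : ℝ) : ℝ :=
  w.1 * (ε * w.2.1 * x - √2 * ε * w.2.2 * (x ^ 2 - 1) / 2)
    - w.1 ^ 2 * (w.2.1 ^ 2 + w.2.2 ^ 2) * ε ^ 2 / 2

/-- The likelihood ratio of one observation `x` at the local parameter `w` and scale `ε`. -/
def mixtureRatio (ε : ℝ) (w : ℝ × ℝ × ℝ) (x : ℝ) : ℝ :=
  1 - w.1 + w.1 * Real.exp (logDensityRatio (ε * w.2.1) (1 + √2 * ε * w.2.2) x)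

theorem mixtureDensity_localParam {ε : ℝ} {w : ℝ × ℝ × ℝ} (hc : 0 < 1 + √2 * ε * w.2.2) (x : ℝ) :
    mixtureDensity (localParam ε w) x = gaussianPDFReal 0 1 x * mixtureRatio ε w x := by
  rw [mixtureDensity, localParam, mixtureRatio]
  simp only
  rw [gaussianPDFReal_eq_mul_exp _ hc]
  ring

theorem likelihood_localParam_div {ε : ℝ} {w : ℝ × ℝ × ℝ} (hc : 0 < 1 + √2 * ε * w.2.2) {n : ℕ}
    (x : Fin n → ℝ) :
    likelihood (localParam ε w) x / ∫ w, likelihood w x ∂nullPrior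
      = ∏ i, mixtureRatio ε w (x i) := by
  have h0 : ∫ w, likelihood w x ∂nullPrior = ∏ i, gaussianPDFReal 0 1 (x i) := by
    rw [nullPrior, integral_dirac]
    simp [likelihood, mixtureDensity]
  have hpos : ∏ i, gaussianPDFReal 0 1 (x i) ≠ 0 :=
    (Finset.prod_pos fun i _ => gaussianPDFReal_pos _ _ _ one_ne_zero).ne'
  rw [h0, likelihood, div_eq_iff hpos, ← Finset.prod_mul_distrib]
  exact Finset.prod_congr rfl fun i _ => by rw [mixtureDensity_localParam hc, mul_comm]

theorem prod_exp_shiftLogRatio {n : ℕ} (hn : 0 < n) (w : ℝ × ℝ × ℝ) (x : Fin n → ℝ) :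
    ∏ i, Real.exp (shiftLogRatio (1 / √n) w (x i))
      = Real.exp (w.1 * (w.2.1 * xiStat x - w.2.2 * etaStat x)
          - w.1 ^ 2 * (w.2.1 ^ 2 + w.2.2 ^ 2) / 2) := by
  have hn' : (0 : ℝ) < n := by exact_mod_cast hn
  have h1 : √(2 * (n : ℝ)) = √2 * √n := Real.sqrt_mul (by norm_num) _
  have h2 : √(2 : ℝ) ^ 2 = 2 := Real.sq_sqrt (by norm_num)
  have h3 : √(n : ℝ) ^ 2 = n := Real.sq_sqrt hn'.le
  have h4 : 1 / (√2 * √(n : ℝ)) = √2 * (1 / √n) / 2 := by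
    field_simp
    exact h2.symm
  rw [← Real.exp_sum, xiStat, etaStat, h1, h4]
  congr 1
  simp only [shiftLogRatio, Finset.sum_sub_distrib, ← Finset.mul_sum, ← Finset.sum_div]
  simp only [Finset.sum_const, Finset.card_univ, Fintype.card_fin, nsmul_eq_mul, div_pow, h3]
  field_simp

/-! ### Closed forms of the mixed moments -/

/-- The mixed exponential moments of the component log-density ratio and the shift log-ratio
under the null hypothesis. -/
def mixedMoment (ε : ℝ) (w : ℝ × ℝ × ℝ) (k j : ℝ) : ℝ :=
  ∫ x, Real.exp (k * logDensityRatio (ε * w.2.1) (1 + √2 * ε * w.2.2) x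
    + j * shiftLogRatio ε w x) ∂gaussianReal 0 1

/-- The explicit logarithm of `mixedMoment`, meaningful when `1 + (k + j a) √2 ε v > 0`, the
condition for the Gaussian integral to converge. -/
def logMixedMoment (ε : ℝ) (w : ℝ × ℝ × ℝ) (k j : ℝ) : ℝ :=
  (k * (Real.log (1 + √2 * ε * w.2.2) / 2 - (1 + √2 * ε * w.2.2) * (ε * w.2.1) ^ 2 / 2)
      + j * (w.1 * (√2 * ε * w.2.2) / 2 - w.1 ^ 2 * (w.2.1 ^ 2 + w.2.2 ^ 2) * ε ^ 2 / 2))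
    - Real.log (1 + (k + j * w.1) * (√2 * ε * w.2.2)) / 2
    + (ε * w.2.1 * (k * (1 + √2 * ε * w.2.2) + j * w.1)) ^ 2
      / (2 * (1 + (k + j * w.1) * (√2 * ε * w.2.2)))

theorem mul_logDensityRatio_add_mul_shiftLogRatio (ε : ℝ) (w : ℝ × ℝ × ℝ) (k j x : ℝ) :
    k * logDensityRatio (ε * w.2.1) (1 + √2 * ε * w.2.2) x + j * shiftLogRatio ε w x
      = ε * w.2.1 * (k * (1 + √2 * ε * w.2.2) + j * w.1) * x
        + (-(k + j * w.1) * (√2 * ε * w.2.2) / 2) * x ^ 2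
        + (k * (Real.log (1 + √2 * ε * w.2.2) / 2 - (1 + √2 * ε * w.2.2) * (ε * w.2.1) ^ 2 / 2)
          + j * (w.1 * (√2 * ε * w.2.2) / 2
            - w.1 ^ 2 * (w.2.1 ^ 2 + w.2.2 ^ 2) * ε ^ 2 / 2)) := by
  rw [logDensityRatio, shiftLogRatio]
  ring

theorem integrable_exp_mixed {ε : ℝ} {w : ℝ × ℝ × ℝ} {k j : ℝ}
    (h : 0 < 1 + (k + j * w.1) * (√2 * ε * w.2.2)) :
    Integrable (fun x => Real.exp (k * logDensityRatio (ε * w.2.1) (1 + √2 * ε * w.2.2) x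
      + j * shiftLogRatio ε w x)) (gaussianReal 0 1) := by
  simp only [mul_logDensityRatio_add_mul_shiftLogRatio]
  exact integrable_exp_quadratic _ _ (by linarith)

theorem mixedMoment_eq_exp {ε : ℝ} {w : ℝ × ℝ × ℝ} {k j : ℝ}
    (h : 0 < 1 + (k + j * w.1) * (√2 * ε * w.2.2)) :
    mixedMoment ε w k j = Real.exp (logMixedMoment ε w k j) := by
  have h' : 1 - 2 * (-(k + j * w.1) * (√2 * ε * w.2.2) / 2)
    = 1 + (k + j * w.1) * (√2 * ε * w.2.2) := by ring
  simp only [mixedMoment, mul_logDensityRatio_add_mul_shiftLogRatio]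
  rw [integral_exp_quadratic _ _ (h' ▸ h), h', logMixedMoment]

/-! ### Uniform second-order expansions -/

theorem isBigO_log_one_add_sub :
    (fun x : ℝ => Real.log (1 + x) - x + x ^ 2 / 2) =O[𝓝 0] fun x => x ^ 3 := by
  have hev : ∀ᶠ x : ℝ in 𝓝 0, |x| < 1 / 2 := by
    have : Tendsto (fun x : ℝ => |x|) (𝓝 0) (𝓝 |0|) := continuous_abs.tendsto 0
    exact this.eventually_lt_const (by norm_num)
  refine IsBigO.of_bound 2 ?_
  filter_upwards [hev] with x hx
  have h := Real.abs_log_sub_add_sum_range_le (x := -x) (by rw [abs_neg]; linarith) 2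
  rw [abs_neg, sub_neg_eq_add] at h
  norm_num [Finset.sum_range_succ] at h
  rw [Real.norm_eq_abs, Real.norm_eq_abs, abs_pow]
  rw [show Real.log (1 + x) - x + x ^ 2 / 2 = -x + x ^ 2 / 2 + Real.log (1 + x) by ring]
  refine h.trans ?_
  rw [div_le_iff₀ (by linarith)]
  nlinarith [pow_nonneg (abs_nonneg x) 3]

theorem isBigO_exp_sub_one_sub :
    (fun x : ℝ => Real.exp x - 1 - x) =O[𝓝 0] fun x => x ^ 2 := by
  have hev : ∀ᶠ x : ℝ in 𝓝 0, |x| < 1 := by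
    have : Tendsto (fun x : ℝ => |x|) (𝓝 0) (𝓝 |0|) := continuous_abs.tendsto 0
    exact this.eventually_lt_const (by norm_num)
  refine IsBigO.of_bound 1 ?_
  filter_upwards [hev] with x hx
  rw [Real.norm_eq_abs, Real.norm_eq_abs, one_mul, abs_of_nonneg (sq_nonneg x)]
  exact Real.abs_exp_sub_one_sub_id_le hx.le

theorem isBigO_log_one_add_sub_self :
    (fun x : ℝ => Real.log (1 + x) - x) =O[𝓝 0] fun x => x ^ 2 := by
  have h1 : (fun x : ℝ => x ^ 3) =O[𝓝 0] fun x => x ^ 2 :=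
    (isLittleO_pow_pow (by norm_num : 2 < 3)).isBigO
  have h2 : (fun x : ℝ => x ^ 2 / 2) =O[𝓝 0] fun x => x ^ 2 := by
    simpa [div_eq_inv_mul] using isBigO_const_mul_self (1 / 2 : ℝ) (fun x : ℝ => x ^ 2) (𝓝 0)
  refine ((isBigO_log_one_add_sub.trans h1).sub h2).congr_left fun x => by ring

/-- The second-order coefficient of `logMixedMoment` at scale `0`. -/
def momentCoeff (w : ℝ × ℝ × ℝ) (k j : ℝ) : ℝ :=
  (w.2.1 ^ 2 + w.2.2 ^ 2) / 2 * ((k + j * w.1) ^ 2 - k - j * w.1 ^ 2)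

section Expansion

variable {ι : Type*} {l : Filter ι} {ε : ι → ℝ} {w : ι → ℝ × ℝ × ℝ}

theorem isBigO_one_const (c : ℝ) : (fun _ : ι => c) =O[l] fun _ => (1 : ℝ) :=
  isBigO_const_const c one_ne_zero l

theorem isBigO_one_mul {f g : ι → ℝ} (hf : f =O[l] fun _ => (1 : ℝ))
    (hg : g =O[l] fun _ => (1 : ℝ)) : (fun i => f i * g i) =O[l] fun _ => (1 : ℝ) := by
  simpa only [mul_one] using hf.mul hg

theorem isBigO_one_pow {f : ι → ℝ} (hf : f =O[l] fun _ => (1 : ℝ)) (m : ℕ) :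
    (fun i => f i ^ m) =O[l] fun _ => (1 : ℝ) := by
  simpa only [one_pow] using hf.pow m

/-- The linear terms of `logMixedMoment` in `p = √2 ε v` cancel, and `momentCoeff` collects the
quadratic ones. -/
theorem logMixedMoment_sub_isBigO (hε : Tendsto ε l (𝓝 0))
    (ha : (fun i => (w i).1) =O[l] fun _ => (1 : ℝ))
    (hu : (fun i => (w i).2.1) =O[l] fun _ => (1 : ℝ))
    (hv : (fun i => (w i).2.2) =O[l] fun _ => (1 : ℝ)) (k j : ℝ) :
    (fun i => logMixedMoment (ε i) (w i) k j - momentCoeff (w i) k j * ε i ^ 2)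
      =O[l] fun i => ε i ^ 3 := by
  set p : ι → ℝ := fun i => √2 * ε i * (w i).2.2 with hp
  set κ : ι → ℝ := fun i => k + j * (w i).1 with hκ
  set q : ι → ℝ := fun i => κ i * p i with hq
  have hε1 : ε =O[l] ε := isBigO_refl _ _
  have hεb : ε =O[l] fun _ => (1 : ℝ) := hε.isBigO_one ℝ
  have hpO : p =O[l] ε := by
    simpa using ((isBigO_one_const √2).mul hε1).mul hv
  have hκO : κ =O[l] fun _ => (1 : ℝ) := 
    (isBigO_one_const k).add (isBigO_one_mul (isBigO_one_const j) ha)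
  have hqO : q =O[l] ε := by simpa using hκO.mul hpO
  have hp0 : Tendsto p l (𝓝 0) := hpO.trans_tendsto hε
  have hq0 : Tendsto q l (𝓝 0) := hqO.trans_tendsto hε
  have hlp : (fun i => Real.log (1 + p i) - p i + p i ^ 2 / 2) =O[l] fun i => ε i ^ 3 :=
    (isBigO_log_one_add_sub.comp_tendsto hp0).trans (hpO.pow 3)
  have hlq : (fun i => Real.log (1 + q i) - q i + q i ^ 2 / 2) =O[l] fun i => ε i ^ 3 :=
    (isBigO_log_one_add_sub.comp_tendsto hq0).trans (hqO.pow 3)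
  have hinv : (fun i => (1 + q i)⁻¹) =O[l] fun _ => (1 : ℝ) := by
    have : Tendsto (fun i => (1 + q i)⁻¹) l (𝓝 (1 + 0)⁻¹) :=
      (hq0.const_add 1).inv₀ (by norm_num)
    exact this.isBigO_one ℝ
  have hpb : p =O[l] fun _ => (1 : ℝ) := hpO.trans hεb
  have he : (fun i => ε i ^ 2 * (w i).2.1 ^ 2 * p i) =O[l] fun i => ε i ^ 3 := by
    have := ((hε1.pow 2).mul (hu.pow 2)).mul hpO
    simpa [← pow_succ] using this
  have hbr : (fun i => 2 * κ i * k + k ^ 2 * p i - κ i ^ 3) =O[l] fun _ => (1 : ℝ) := by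
    have h1 := ((isBigO_one_const 2).mul hκO).mul (isBigO_one_const k)
    have h2 := (isBigO_one_const (k ^ 2)).mul hpb
    have h3 := hκO.pow 3
    simp only [mul_one, one_pow] at h1 h2 h3
    exact (h1.add h2).sub h3
  have hrem : (fun i => ε i ^ 2 * (w i).2.1 ^ 2 * p i
      * ((2 * κ i * k + k ^ 2 * p i - κ i ^ 3) * (1 + q i)⁻¹)) =O[l] fun i => ε i ^ 3 := by
    simpa using he.mul (hbr.mul hinv)
  have hall := (((hlp.const_mul_left (k / 2)).sub (hlq.const_mul_left (1 / 2))).sub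
    (he.const_mul_left (k / 2))).add (hrem.const_mul_left (1 / 2))
  refine hall.congr' ?_ EventuallyEq.rfl
  have hpos : ∀ᶠ i in l, -1 < q i := hq0.eventually_const_lt (by norm_num)
  filter_upwards [hpos] with i hi
  have hne : 1 + q i ≠ 0 := by linarith
  have h2 : √(2 : ℝ) ^ 2 = 2 := Real.sq_sqrt (by norm_num)
  have hp2 : p i ^ 2 = 2 * ε i ^ 2 * (w i).2.2 ^ 2 := by
    simp only [hp]
    linear_combination ε i ^ 2 * (w i).2.2 ^ 2 * h2
  have e1 : logMixedMoment (ε i) (w i) k j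
      = (k * (Real.log (1 + p i) / 2 - (1 + p i) * (ε i * (w i).2.1) ^ 2 / 2)
      + j * ((w i).1 * p i / 2 - (w i).1 ^ 2 * ((w i).2.1 ^ 2 + (w i).2.2 ^ 2) * ε i ^ 2 / 2))
    - Real.log (1 + q i) / 2
    + (ε i * (w i).2.1) ^ 2 * (κ i + k * p i) ^ 2 / (2 * (1 + q i)) := by
    simp only [logMixedMoment, hp, hq, hκ]
    ring
  have e2 : (κ i + k * p i) ^ 2 / (2 * (1 + q i))
      = κ i ^ 2 / 2 + p i * ((2 * κ i * k + k ^ 2 * p i - κ i ^ 3) * (1 + q i)⁻¹) / 2 := by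
    field_simp
    simp only [hq]
    ring
  have e3 : j * (w i).1 = κ i - k := by simp only [hκ]; ring
  rw [e1, mul_div_assoc _ ((κ i + k * p i) ^ 2), e2, momentCoeff, mul_sub j,
    show j * ((w i).1 * p i / 2) = j * (w i).1 * p i / 2 by ring, e3]
  have e4 : q i ^ 2 = κ i ^ 2 * p i ^ 2 := by simp only [hq]; ring
  have e5 : q i = κ i * p i := rfl
  have e6 : k + (κ i - k) = κ i := by ring
  rw [e4, e6, hp2]
  generalize (1 + q i)⁻¹ = r
  generalize Real.log (1 + q i) = L
  rw [e5]
  ring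

theorem momentCoeff_isBigO
    (ha : (fun i => (w i).1) =O[l] fun _ => (1 : ℝ))
    (hu : (fun i => (w i).2.1) =O[l] fun _ => (1 : ℝ))
    (hv : (fun i => (w i).2.2) =O[l] fun _ => (1 : ℝ)) (k j : ℝ) :
    (fun i => momentCoeff (w i) k j) =O[l] fun _ => (1 : ℝ) := by
  have h1 := isBigO_one_mul (isBigO_one_mul ((isBigO_one_pow hu 2).add (isBigO_one_pow hv 2))
    (((isBigO_one_pow ((isBigO_one_const k).add (isBigO_one_mul (isBigO_one_const j) ha)) 2).sub
      (isBigO_one_const k)).sub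
      (isBigO_one_mul (isBigO_one_const j) (isBigO_one_pow ha 2)))) (isBigO_one_const (1 / 2))
  refine h1.congr_left fun i => ?_
  rw [momentCoeff]
  ring

theorem mixedMoment_sub_isLittleO (hε : Tendsto ε l (𝓝 0))
    (ha : (fun i => (w i).1) =O[l] fun _ => (1 : ℝ))
    (hu : (fun i => (w i).2.1) =O[l] fun _ => (1 : ℝ))
    (hv : (fun i => (w i).2.2) =O[l] fun _ => (1 : ℝ)) (k j : ℝ) :
    (fun i => mixedMoment (ε i) (w i) k j - 1 - momentCoeff (w i) k j * ε i ^ 2)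
      =o[l] fun i => ε i ^ 2 := by
  have h1 := logMixedMoment_sub_isBigO hε ha hu hv k j
  have h32 : (fun i => ε i ^ 3) =o[l] fun i => ε i ^ 2 :=
    (isLittleO_pow_pow (by norm_num : 2 < 3)).comp_tendsto hε
  have h42 : (fun i => (ε i ^ 2) ^ 2) =o[l] fun i => ε i ^ 2 := by
    simp only [← pow_mul]
    exact (isLittleO_pow_pow (by norm_num : 2 < 4)).comp_tendsto hε
  have hψ : (fun i => logMixedMoment (ε i) (w i) k j) =O[l] fun i => ε i ^ 2 := by
    have hD := (momentCoeff_isBigO ha hu hv k j).mul (isBigO_refl (fun i => ε i ^ 2) l)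
    simp only [one_mul] at hD
    exact ((h1.trans h32.isBigO).add hD).congr_left fun i => by ring
  have hε2 : Tendsto (fun i => ε i ^ 2) l (𝓝 0) := by simpa using hε.pow 2
  have hψ0 := hψ.trans_tendsto hε2
  have h2 := (isBigO_exp_sub_one_sub.comp_tendsto hψ0).trans (hψ.pow 2)
  refine ((h2.trans_isLittleO h42).add (h1.trans_isLittleO h32)).congr' ?_ EventuallyEq.rfl
  have hpos : Tendsto (fun i => 1 + (k + j * (w i).1) * (√2 * ε i * (w i).2.2)) l (𝓝 (1 + 0)) := by
    refine Tendsto.const_add 1 ?_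
    have := ((isBigO_one_const k).add (isBigO_one_mul (isBigO_one_const j) ha)).mul
      (((isBigO_one_const √2).mul (isBigO_refl ε l)).mul hv)
    simp only [mul_one, one_mul] at this
    exact this.trans_tendsto hε
  filter_upwards [hpos.eventually_const_lt (show (0 : ℝ) < 1 + 0 by norm_num)] with i hi
  rw [mixedMoment_eq_exp hi]
  simp only [Function.comp]
  ring

/-- Uniform version of `(1 + D / n)ⁿ → exp D`, with `ε = n^(-1/2)`. -/
theorem tendsto_pow_sub_exp (hε : Tendsto ε l (𝓝 0)) {N : ι → ℕ}
    (hN : ∀ᶠ i in l, N i * ε i ^ 2 = 1) {F D : ι → ℝ} (hD : D =O[l] fun _ => (1 : ℝ))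
    (hF : (fun i => F i - 1 - D i * ε i ^ 2) =o[l] fun i => ε i ^ 2) :
    Tendsto (fun i => F i ^ N i - Real.exp (D i)) l (𝓝 0) := by
  have hD2 := hD.mul (isBigO_refl (fun i => ε i ^ 2) l)
  simp only [one_mul] at hD2
  have h42 : (fun i => (ε i ^ 2) ^ 2) =o[l] fun i => ε i ^ 2 := by
    simp only [← pow_mul]
    exact (isLittleO_pow_pow (by norm_num : 2 < 4)).comp_tendsto hε
  have hε2 : Tendsto (fun i => ε i ^ 2) l (𝓝 0) := by simpa using hε.pow 2
  have hF1 : (fun i => F i - 1) =O[l] fun i => ε i ^ 2 :=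
    (hF.isBigO.add hD2).congr_left fun i => by ring
  have hF0 := hF1.trans_tendsto hε2
  have h1 := ((isBigO_log_one_add_sub_self.comp_tendsto hF0).trans (hF1.pow 2)).trans_isLittleO h42
  have h2 := (h1.add hF).tendsto_div_nhds_zero
  have h3 : Tendsto (fun i => N i * Real.log (F i) - D i) l (𝓝 0) := by
    refine h2.congr' ?_
    filter_upwards [hN] with i hi
    have hne : ε i ^ 2 ≠ 0 := fun h => by simp [h] at hi
    simp only [Function.comp, add_sub_cancel]
    rw [div_eq_iff hne]
    linear_combination (-Real.log (F i)) * hi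
  have hexpD : (fun i => Real.exp (D i)) =O[l] fun _ => (1 : ℝ) := by
    obtain ⟨C, hC⟩ := hD.bound
    refine IsBigO.of_bound (Real.exp C) ?_
    filter_upwards [hC] with i hi
    simp only [Real.norm_eq_abs, abs_one, mul_one, Real.abs_exp] at hi ⊢
    exact Real.exp_le_exp.2 ((le_abs_self _).trans hi)
  have h4 : Tendsto (fun i => Real.exp (N i * Real.log (F i) - D i) - 1) l (𝓝 0) := by
    have := ((Real.continuous_exp.tendsto 0).comp h3).sub_const 1
    simpa using this
  have h5 := (hexpD.mul (isBigO_refl (fun i => Real.exp (N i * Real.log (F i) - D i) - 1) l))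
  simp only [one_mul] at h5
  refine (h5.trans_tendsto h4).congr' ?_
  filter_upwards [hF0.eventually_const_lt (show (-1 : ℝ) < 0 by norm_num)] with i hi
  have hpos : 0 < F i := by linarith
  rw [mul_sub, ← Real.exp_add, mul_one, add_sub_cancel, mul_comm, Real.exp_mul, Real.exp_log hpos,
    Real.rpow_natCast]

end Expansion

/-! ### Mean square distance -/

/-- `E[(mixtureRatio)²]` under the null hypothesis. -/
def ratioSqMoment (ε : ℝ) (w : ℝ × ℝ × ℝ) : ℝ :=
  (1 - w.1) ^ 2 + 2 * w.1 * (1 - w.1) * mixedMoment ε w 1 0 + w.1 ^ 2 * mixedMoment ε w 2 0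

/-- `E[mixtureRatio * exp shiftLogRatio]` under the null hypothesis. -/
def crossMoment (ε : ℝ) (w : ℝ × ℝ × ℝ) : ℝ :=
  (1 - w.1) * mixedMoment ε w 0 1 + w.1 * mixedMoment ε w 1 1

/-- The left side is `E[(Z - W)²]`, for the likelihood ratio `Z` of the sample and the limiting
ratio `W`. All three powers approach the same value `exp (a² (u² + v²))`, along any filter on which
the local parameters stay bounded. -/
theorem tendsto_secondMoment {ι : Type*} {l : Filter ι} {ε : ι → ℝ} {w : ι → ℝ × ℝ × ℝ}
    (hε : Tendsto ε l (𝓝 0)) {N : ι → ℕ} (hN : ∀ᶠ i in l, N i * ε i ^ 2 = 1)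
    (ha : (fun i => (w i).1) =O[l] fun _ => (1 : ℝ))
    (hu : (fun i => (w i).2.1) =O[l] fun _ => (1 : ℝ))
    (hv : (fun i => (w i).2.2) =O[l] fun _ => (1 : ℝ)) :
    Tendsto (fun i => ratioSqMoment (ε i) (w i) ^ N i - 2 * crossMoment (ε i) (w i) ^ N i
      + mixedMoment (ε i) (w i) 0 2 ^ N i) l (𝓝 0) := by
  have hM := mixedMoment_sub_isLittleO hε ha hu hv
  have hD : (fun i => (w i).1 ^ 2 * ((w i).2.1 ^ 2 + (w i).2.2 ^ 2)) =O[l] fun _ => (1 : ℝ) :=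
    isBigO_one_mul (isBigO_one_pow ha 2) ((isBigO_one_pow hu 2).add (isBigO_one_pow hv 2))
  have hmul : ∀ {f g : ι → ℝ}, f =O[l] (fun _ => (1 : ℝ)) → g =o[l] (fun i => ε i ^ 2) →
      (fun i => f i * g i) =o[l] fun i => ε i ^ 2 := by
    intro f g hf hg
    simpa only [one_mul] using hf.mul_isLittleO hg
  have ha' : (fun i => 1 - (w i).1) =O[l] fun _ => (1 : ℝ) := (isBigO_one_const 1).sub ha
  have hA := tendsto_pow_sub_exp (F := fun i => ratioSqMoment (ε i) (w i)) hε hN hD (by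
    refine ((hmul (isBigO_one_mul (isBigO_one_mul (isBigO_one_const 2) ha) ha') (hM 1 0)).add
      (hmul (isBigO_one_pow ha 2) (hM 2 0))).congr_left fun i => ?_
    simp only [ratioSqMoment, momentCoeff]
    ring)
  have hB := tendsto_pow_sub_exp (F := fun i => crossMoment (ε i) (w i)) hε hN hD (by
    refine ((hmul ha' (hM 0 1)).add (hmul ha (hM 1 1))).congr_left fun i => ?_
    simp only [crossMoment, momentCoeff]
    ring)
  have hC := tendsto_pow_sub_exp (F := fun i => mixedMoment (ε i) (w i) 0 2) hε hN hD (by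
    refine (hM 0 2).congr_left fun i => ?_
    simp only [momentCoeff]
    ring)
  have := (hA.sub (hB.const_mul 2)).add hC
  simp only [mul_zero, sub_zero, add_zero] at this
  exact this.congr fun i => by ring

/-- Uniformity over the prior's support comes from taking the limit along
`atTop ×ˢ 𝓟 (Ioo 0 1 ×ˢ disc R)`, that is, with the local parameter allowed to vary with `n`. -/
theorem eventually_forall_secondMoment_lt {R : ℝ} (hR : 0 < R) {δ : ℝ} (hδ : 0 < δ) :
    ∀ᶠ n : ℕ in atTop, ∀ w ∈ Set.Ioo (0 : ℝ) 1 ×ˢ disc R,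
      |√2 * (1 / √n) * w.2.2| < 1 / 2 ∧
      ratioSqMoment (1 / √n) w ^ n - 2 * crossMoment (1 / √n) w ^ n
        + mixedMoment (1 / √n) w 0 2 ^ n < δ := by
  rw [← eventually_prod_principal_iff
    (p := fun z : ℕ × (ℝ × ℝ × ℝ) => |√2 * (1 / √z.1) * z.2.2.2| < 1 / 2 ∧
      ratioSqMoment (1 / √z.1) z.2 ^ z.1 - 2 * crossMoment (1 / √z.1) z.2 ^ z.1
        + mixedMoment (1 / √z.1) z.2 0 2 ^ z.1 < δ)]
  set l := (atTop : Filter ℕ) ×ˢ 𝓟 (Set.Ioo (0 : ℝ) 1 ×ˢ disc R)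
  have h0 : Tendsto (fun n : ℕ => 1 / √(n : ℝ)) atTop (𝓝 0) := by
    simp only [one_div]
    exact (Real.tendsto_sqrt_atTop.comp tendsto_natCast_atTop_atTop).inv_tendsto_atTop
  have hε : Tendsto (fun z : ℕ × (ℝ × ℝ × ℝ) => 1 / √(z.1 : ℝ)) l (𝓝 0) := h0.comp tendsto_fst
  have hmem : ∀ᶠ z : ℕ × (ℝ × ℝ × ℝ) in l, z.2 ∈ Set.Ioo (0 : ℝ) 1 ×ˢ disc R :=
    eventually_prod_principal_iff.2 (Eventually.of_forall fun _ _ h => h)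
  have hN : ∀ᶠ z : ℕ × (ℝ × ℝ × ℝ) in l, (z.1 : ℝ) * (1 / √(z.1 : ℝ)) ^ 2 = 1 := by
    have : ∀ᶠ n : ℕ in atTop, (n : ℝ) * (1 / √(n : ℝ)) ^ 2 = 1 := by
      filter_upwards [eventually_gt_atTop 0] with n hn
      have hn' : (0 : ℝ) < n := by exact_mod_cast hn
      rw [div_pow, Real.sq_sqrt hn'.le]
      field_simp
    exact tendsto_fst.eventually this
  have ha : (fun z : ℕ × (ℝ × ℝ × ℝ) => z.2.1) =O[l] fun _ => (1 : ℝ) := by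
    refine IsBigO.of_bound 1 ?_
    filter_upwards [hmem] with z hz
    simpa using abs_le.2 ⟨by linarith [hz.1.1], hz.1.2.le⟩
  have hu : (fun z : ℕ × (ℝ × ℝ × ℝ) => z.2.2.1) =O[l] fun _ => (1 : ℝ) := by
    refine IsBigO.of_bound R ?_
    filter_upwards [hmem] with z hz
    simpa using abs_le.2 (disc_subset hR hz.2).1
  have hv : (fun z : ℕ × (ℝ × ℝ × ℝ) => z.2.2.2) =O[l] fun _ => (1 : ℝ) := by
    refine IsBigO.of_bound R ?_
    filter_upwards [hmem] with z hz
    simpa using abs_le.2 (disc_subset hR hz.2).2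
  have h1 := (tendsto_secondMoment hε hN ha hu hv).eventually_lt_const hδ
  have hp : Tendsto (fun z : ℕ × (ℝ × ℝ × ℝ) => |√2 * (1 / √z.1) * z.2.2.2|) l (𝓝 0) := by
    have := ((isBigO_one_const √2).mul (isBigO_refl
      (fun z : ℕ × (ℝ × ℝ × ℝ) => 1 / √(z.1 : ℝ)) l)).mul hv
    simp only [one_mul, mul_one] at this
    simpa using (this.trans_tendsto hε).abs
  filter_upwards [h1, hp.eventually_lt_const (show (0 : ℝ) < 1 / 2 by norm_num)] with z hz1 hz2
  exact ⟨hz2, hz1⟩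

theorem one_add_mul_pos {κ p : ℝ} (hp : |p| < 1 / 2) (h0 : 0 ≤ κ) (h2 : κ ≤ 2) :
    0 < 1 + κ * p := by
  have := abs_lt.1 hp
  nlinarith

theorem integrable_and_integral_mixtureRatio_sq {ε : ℝ} {w : ℝ × ℝ × ℝ}
    (hp : |√2 * ε * w.2.2| < 1 / 2) :
    Integrable (fun x => mixtureRatio ε w x ^ 2) (gaussianReal 0 1) ∧
      ∫ x, mixtureRatio ε w x ^ 2 ∂gaussianReal 0 1 = ratioSqMoment ε w := by
  have h1 := integrable_exp_mixed (ε := ε) (w := w) (k := 1) (j := 0)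
    (one_add_mul_pos hp (by norm_num) (by norm_num))
  have h2 := integrable_exp_mixed (ε := ε) (w := w) (k := 2) (j := 0)
    (one_add_mul_pos hp (by norm_num) (by norm_num))
  have e : ∀ x, mixtureRatio ε w x ^ 2 = ((1 - w.1) ^ 2 + 2 * w.1 * (1 - w.1)
      * Real.exp (1 * logDensityRatio (ε * w.2.1) (1 + √2 * ε * w.2.2) x + 0 * shiftLogRatio ε w x))
      + w.1 ^ 2 * Real.exp (2 * logDensityRatio (ε * w.2.1) (1 + √2 * ε * w.2.2) x
        + 0 * shiftLogRatio ε w x) := by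
    intro x
    rw [mixtureRatio, one_mul, zero_mul, add_zero, add_zero,
      two_mul (logDensityRatio _ _ _), Real.exp_add]
    ring
  have h12 : Integrable (fun x => (1 - w.1) ^ 2 + 2 * w.1 * (1 - w.1)
      * Real.exp (1 * logDensityRatio (ε * w.2.1) (1 + √2 * ε * w.2.2) x + 0 * shiftLogRatio ε w x))
      (gaussianReal 0 1) := (integrable_const _).add (h1.const_mul _)
  simp only [e]
  refine ⟨h12.add (h2.const_mul _), ?_⟩
  rw [integral_add h12 (h2.const_mul _),
    integral_add (integrable_const _) (h1.const_mul _), integral_const_mul, integral_const_mul,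
    ratioSqMoment, mixedMoment, mixedMoment]
  simp

theorem integrable_and_integral_mixtureRatio_mul {ε : ℝ} {w : ℝ × ℝ × ℝ}
    (ha : w.1 ∈ Set.Ioo (0 : ℝ) 1)
    (hp : |√2 * ε * w.2.2| < 1 / 2) :
    Integrable (fun x => mixtureRatio ε w x * Real.exp (shiftLogRatio ε w x)) (gaussianReal 0 1) ∧
      ∫ x, mixtureRatio ε w x * Real.exp (shiftLogRatio ε w x) ∂gaussianReal 0 1
        = crossMoment ε w := by
  have h1 := integrable_exp_mixed (ε := ε) (w := w) (k := 0) (j := 1)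
    (one_add_mul_pos hp (by linarith [ha.1]) (by linarith [ha.2]))
  have h2 := integrable_exp_mixed (ε := ε) (w := w) (k := 1) (j := 1)
    (one_add_mul_pos hp (by linarith [ha.1]) (by linarith [ha.2]))
  have e : ∀ x, mixtureRatio ε w x * Real.exp (shiftLogRatio ε w x) = (1 - w.1)
      * Real.exp (0 * logDensityRatio (ε * w.2.1) (1 + √2 * ε * w.2.2) x + 1 * shiftLogRatio ε w x)
      + w.1 * Real.exp (1 * logDensityRatio (ε * w.2.1) (1 + √2 * ε * w.2.2) x
        + 1 * shiftLogRatio ε w x) := by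
    intro x
    rw [mixtureRatio, one_mul, one_mul, zero_mul, zero_add, Real.exp_add]
    ring
  simp only [e]
  refine ⟨(h1.const_mul _).add (h2.const_mul _), ?_⟩
  rw [integral_add (h1.const_mul _) (h2.const_mul _), integral_const_mul, integral_const_mul,
    crossMoment, mixedMoment, mixedMoment]

theorem integrable_and_integral_exp_shiftLogRatio_sq {ε : ℝ} {w : ℝ × ℝ × ℝ}
    (ha : w.1 ∈ Set.Ioo (0 : ℝ) 1)
    (hp : |√2 * ε * w.2.2| < 1 / 2) :
    Integrable (fun x => Real.exp (shiftLogRatio ε w x) ^ 2) (gaussianReal 0 1) ∧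
      ∫ x, Real.exp (shiftLogRatio ε w x) ^ 2 ∂gaussianReal 0 1 = mixedMoment ε w 0 2 := by
  have h1 := integrable_exp_mixed (ε := ε) (w := w) (k := 0) (j := 2)
    (one_add_mul_pos hp (by linarith [ha.1]) (by linarith [ha.2]))
  have e : ∀ x, Real.exp (shiftLogRatio ε w x) ^ 2
      = Real.exp (0 * logDensityRatio (ε * w.2.1) (1 + √2 * ε * w.2.2) x
        + 2 * shiftLogRatio ε w x) := by
    intro x
    rw [zero_mul, zero_add, two_mul, Real.exp_add]
    ring
  simp only [e]
  exact ⟨h1, rfl⟩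

/-- The law of a sample of size `n` under the null hypothesis. -/
def nullSample (n : ℕ) : Measure (Fin n → ℝ) := Measure.pi fun _ => gaussianReal 0 1

instance (n : ℕ) : IsProbabilityMeasure (nullSample n) := by
  unfold nullSample
  infer_instance

/-- The difference between the likelihood ratio of the sample and that of the limiting Gaussian
shift experiment. -/
def ratioGap (ε : ℝ) {n : ℕ} (w : ℝ × ℝ × ℝ) (x : Fin n → ℝ) : ℝ :=
  ∏ i, mixtureRatio ε w (x i) - ∏ i, Real.exp (shiftLogRatio ε w (x i))

theorem measurable_uncurry_ratioGap (ε : ℝ) (n : ℕ) :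
    Measurable (Function.uncurry (ratioGap ε (n := n))) := by
  unfold ratioGap mixtureRatio shiftLogRatio logDensityRatio Function.uncurry
  fun_prop

theorem integrable_and_integral_ratioGap_sq {ε : ℝ} {w : ℝ × ℝ × ℝ}
    (ha : w.1 ∈ Set.Ioo (0 : ℝ) 1)
    (hp : |√2 * ε * w.2.2| < 1 / 2) (n : ℕ) :
    Integrable (fun x => ratioGap ε w x ^ 2) (nullSample n) ∧
      ∫ x, ratioGap ε w x ^ 2 ∂nullSample n
        = ratioSqMoment ε w ^ n - 2 * crossMoment ε w ^ n + mixedMoment ε w 0 2 ^ n := by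
  obtain ⟨i1, e1⟩ := integrable_and_integral_mixtureRatio_sq hp
  obtain ⟨i2, e2⟩ := integrable_and_integral_mixtureRatio_mul ha hp
  obtain ⟨i3, e3⟩ := integrable_and_integral_exp_shiftLogRatio_sq ha hp
  have I1 : Integrable (fun x : Fin n → ℝ => ∏ i, mixtureRatio ε w (x i) ^ 2) (nullSample n) :=
    Integrable.fintype_prod fun _ => i1
  have I2 : Integrable (fun x : Fin n → ℝ =>
      ∏ i, (mixtureRatio ε w (x i) * Real.exp (shiftLogRatio ε w (x i)))) (nullSample n) :=
    Integrable.fintype_prod (f := fun _ y => mixtureRatio ε w y * Real.exp (shiftLogRatio ε w y))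
      fun _ => i2
  have I3 : Integrable (fun x : Fin n → ℝ => ∏ i, Real.exp (shiftLogRatio ε w (x i)) ^ 2)
      (nullSample n) := Integrable.fintype_prod fun _ => i3
  have e : ∀ x : Fin n → ℝ, ratioGap ε w x ^ 2 = (∏ i, mixtureRatio ε w (x i) ^ 2
      - 2 * ∏ i, (mixtureRatio ε w (x i) * Real.exp (shiftLogRatio ε w (x i))))
      + ∏ i, Real.exp (shiftLogRatio ε w (x i)) ^ 2 := by
    intro x
    simp only [ratioGap, Finset.prod_pow, Finset.prod_mul_distrib]
    ring
  simp only [e]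
  have I12 : Integrable (fun x : Fin n → ℝ => ∏ i, mixtureRatio ε w (x i) ^ 2
      - 2 * ∏ i, (mixtureRatio ε w (x i) * Real.exp (shiftLogRatio ε w (x i)))) (nullSample n) :=
    I1.sub (I2.const_mul 2)
  refine ⟨I12.add I3, ?_⟩
  rw [integral_add I12 I3, integral_sub I1 (I2.const_mul 2),
    integral_const_mul, nullSample,
    integral_fintype_prod_eq_pow (fun y => mixtureRatio ε w y ^ 2),
    integral_fintype_prod_eq_pow (fun y => mixtureRatio ε w y * Real.exp (shiftLogRatio ε w y)),
    integral_fintype_prod_eq_pow (fun y => Real.exp (shiftLogRatio ε w y) ^ 2),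
    e1, e2, e3, Fintype.card_fin]

/-- A bound on the mean absolute value from one on the mean square. -/
theorem lintegral_enorm_le_of_integral_sq_le {α : Type*} [MeasurableSpace α] {μ : Measure α}
    [IsProbabilityMeasure μ] {f : α → ℝ} (hf : Integrable (fun x => f x ^ 2) μ) {δ : ℝ}
    (hδ : 0 < δ) (h : ∫ x, f x ^ 2 ∂μ ≤ δ ^ 2) : ∫⁻ x, ‖f x‖ₑ ∂μ ≤ ENNReal.ofReal δ := by
  -- The arithmetic-geometric mean inequality replaces Cauchy-Schwarz.
  have hpt : ∀ x, |f x| ≤ δ / 2 + f x ^ 2 / (2 * δ) := by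
    intro x
    rw [← sub_nonneg]
    have : δ / 2 + f x ^ 2 / (2 * δ) - |f x| = (|f x| - δ) ^ 2 / (2 * δ) := by
      rw [← sq_abs (f x)]
      field_simp
      ring
    rw [this]
    positivity
  have hint : Integrable (fun x => δ / 2 + f x ^ 2 / (2 * δ)) μ :=
    (integrable_const _).add (hf.div_const _)
  calc ∫⁻ x, ‖f x‖ₑ ∂μ ≤ ∫⁻ x, ENNReal.ofReal (δ / 2 + f x ^ 2 / (2 * δ)) ∂μ := by
        refine lintegral_mono fun x => ?_
        rw [Real.enorm_eq_ofReal_abs]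
        exact ENNReal.ofReal_le_ofReal (hpt x)
    _ = ENNReal.ofReal (∫ x, (δ / 2 + f x ^ 2 / (2 * δ)) ∂μ) := by
        rw [ofReal_integral_eq_lintegral_ofReal hint
          (ae_of_all _ fun x => by positivity)]
    _ ≤ ENNReal.ofReal δ := by
        refine ENNReal.ofReal_le_ofReal ?_
        rw [integral_add (integrable_const _) (hf.div_const _), integral_const, probReal_univ,
          one_smul, integral_div]
        have : (∫ x, f x ^ 2 ∂μ) / (2 * δ) ≤ δ ^ 2 / (2 * δ) := by gcongr
        have h2 : δ ^ 2 / (2 * δ) = δ / 2 := by field_simp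
        linarith

/-! ### Comparison of the marginal likelihood ratio with its limit -/

theorem measurable_likelihood {n : ℕ} (x : Fin n → ℝ) :
    Measurable fun w : ℝ × ℝ × ℝ => likelihood w x := by
  unfold likelihood mixtureDensity gaussianPDFReal
  fun_prop

theorem mixtureRatio_nonneg {ε : ℝ} {w : ℝ × ℝ × ℝ} (ha : w.1 ∈ Set.Ioo (0 : ℝ) 1) (x : ℝ) :
    0 ≤ mixtureRatio ε w x := by
  have h0 := ha.1
  have h1 : 0 ≤ 1 - w.1 := by linarith [ha.2]
  unfold mixtureRatio
  positivity

theorem mixtureRatio_le {ε : ℝ} {w : ℝ × ℝ × ℝ} (ha : w.1 ∈ Set.Ioo (0 : ℝ) 1)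
    (hp : |√2 * ε * w.2.2| < 1 / 2) (x : ℝ) :
    mixtureRatio ε w x ≤ 1 + Real.exp (1 + x ^ 2 / 2) := by
  have hc : 0 < 1 + √2 * ε * w.2.2 := by linarith [(abs_lt.1 hp).1]
  have hlog : Real.log (1 + √2 * ε * w.2.2) ≤ 1 := by
    linarith [Real.log_le_sub_one_of_pos hc, (abs_lt.1 hp).2]
  have h1 : logDensityRatio (ε * w.2.1) (1 + √2 * ε * w.2.2) x ≤ 1 + x ^ 2 / 2 := by
    rw [logDensityRatio]
    nlinarith [mul_nonneg hc.le (sq_nonneg (x - ε * w.2.1))]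
  have h2 := Real.exp_le_exp.2 h1
  have h3 := Real.exp_pos (logDensityRatio (ε * w.2.1) (1 + √2 * ε * w.2.2) x)
  unfold mixtureRatio
  nlinarith [ha.1, ha.2]

/-- For a fixed sample the likelihood ratio is a bounded function of the parameter, as long as the
precision `c` stays away from `0`. -/
theorem integrable_prod_mixtureRatio {R : ℝ} (hR : 0 < R) {ε : ℝ}
    (hp : ∀ w ∈ Set.Ioo (0 : ℝ) 1 ×ˢ disc R, |√2 * ε * w.2.2| < 1 / 2) {n : ℕ} (x : Fin n → ℝ) :
    Integrable (fun w => ∏ i, mixtureRatio ε w (x i)) (discPrior R) := by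
  have := isProbabilityMeasure_discPrior hR
  refine Integrable.of_bound (C := ∏ i, (1 + Real.exp (1 + x i ^ 2 / 2))) ?_ ?_
  · refine Measurable.aestronglyMeasurable ?_
    unfold mixtureRatio logDensityRatio
    fun_prop
  · filter_upwards [ae_discPrior_mem R] with w hw
    rw [Real.norm_eq_abs, abs_of_nonneg (Finset.prod_nonneg fun i _ => mixtureRatio_nonneg hw.1 _)]
    exact Finset.prod_le_prod (fun i _ => mixtureRatio_nonneg hw.1 _)
      fun i _ => mixtureRatio_le hw.1 (hp w hw) _

theorem marginalLikelihoodRatio_sub_limitRatio {R : ℝ} (hR : 0 < R) {n : ℕ} (hn : 0 < n)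
    (hp : ∀ w ∈ Set.Ioo (0 : ℝ) 1 ×ˢ disc R, |√2 * (1 / √n) * w.2.2| < 1 / 2) (x : Fin n → ℝ) :
    marginalLikelihoodRatio (altPrior R n) nullPrior x - limitRatio R (XiStat x)
      = ∫ w, ratioGap (1 / √n) w x ∂discPrior R := by
  have h1 : marginalLikelihoodRatio (altPrior R n) nullPrior x
      = ∫ w, ∏ i, mixtureRatio (1 / √n) w (x i) ∂discPrior R := by
    rw [marginalLikelihoodRatio, integral_altPrior hR hn (measurable_likelihood x), ← integral_div]
    refine integral_congr_ae ?_
    filter_upwards [ae_discPrior_mem R] with w hw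
    exact likelihood_localParam_div (by linarith [(abs_lt.1 (hp w hw)).1]) x
  have h2 : limitRatio R (XiStat x)
      = ∫ w, ∏ i, Real.exp (shiftLogRatio (1 / √n) w (x i)) ∂discPrior R := by
    simp only [prod_exp_shiftLogRatio hn]
    rw [XiStat, integral_discPrior_exp hR]
  have h3 : Integrable (fun w => ∏ i, Real.exp (shiftLogRatio (1 / √n) w (x i)))
      (discPrior R) := by
    simp only [prod_exp_shiftLogRatio hn]
    exact integrable_discPrior_exp hR _ _
  rw [h1, h2, ← integral_sub (integrable_prod_mixtureRatio hR hp x) h3]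
  rfl

/-- Markov's inequality for the average over the prior of `|Z - W|`, whose mean Tonelli's theorem
bounds by the supremum over the parameter of the root mean square. -/
theorem nullSample_le_of_secondMoment {R : ℝ} (hR : 0 < R) {n : ℕ} (hn : 0 < n) {δ : ℝ}
    (hδ : 0 < δ)
    (h : ∀ w ∈ Set.Ioo (0 : ℝ) 1 ×ˢ disc R, |√2 * (1 / √n) * w.2.2| < 1 / 2 ∧
      ratioSqMoment (1 / √n) w ^ n - 2 * crossMoment (1 / √n) w ^ n
        + mixedMoment (1 / √n) w 0 2 ^ n < δ ^ 2) {t : ℝ} (ht : 0 < t) :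
    nullSample n {x | t ≤ ‖marginalLikelihoodRatio (altPrior R n) nullPrior x
      - limitRatio R (XiStat x)‖} ≤ ENNReal.ofReal (δ / t) := by
  have := isProbabilityMeasure_discPrior hR
  have hmeas := measurable_uncurry_ratioGap (1 / √n) n
  set g : (Fin n → ℝ) → ENNReal := fun x => ∫⁻ w, ‖ratioGap (1 / √n) w x‖ₑ ∂discPrior R with hg
  have hgm : Measurable g :=
    Measurable.lintegral_prod_left' (f := fun z : (ℝ × ℝ × ℝ) × (Fin n → ℝ) =>
      ‖ratioGap (1 / √n) z.1 z.2‖ₑ) hmeas.enorm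
  have hgint : ∫⁻ x, g x ∂nullSample n ≤ ENNReal.ofReal δ := by
    rw [hg, lintegral_lintegral_swap (f := fun x w => ‖ratioGap (1 / √n) w x‖ₑ)
      (hmeas.comp measurable_swap).enorm.aemeasurable]
    have : ∀ᵐ w ∂discPrior R, ∫⁻ x, ‖ratioGap (1 / √n) w x‖ₑ ∂nullSample n
        ≤ ENNReal.ofReal δ := by
      filter_upwards [ae_discPrior_mem R] with w hw
      obtain ⟨hi, he⟩ := integrable_and_integral_ratioGap_sq hw.1 (h w hw).1 n
      exact lintegral_enorm_le_of_integral_sq_le hi hδ (he.trans_le (h w hw).2.le)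
    refine (lintegral_mono_ae this).trans ?_
    simp
  have hsub : {x | t ≤ ‖marginalLikelihoodRatio (altPrior R n) nullPrior x
      - limitRatio R (XiStat x)‖} ⊆ {x | ENNReal.ofReal t ≤ g x} := by
    intro x hx
    have hx : t ≤ ‖_‖ := hx
    rw [marginalLikelihoodRatio_sub_limitRatio hR hn (fun w hw => (h w hw).1)] at hx
    calc ENNReal.ofReal t ≤ ENNReal.ofReal ‖∫ w, ratioGap (1 / √n) w x ∂discPrior R‖ :=
          ENNReal.ofReal_le_ofReal hx
      _ = ‖∫ w, ratioGap (1 / √n) w x ∂discPrior R‖ₑ := ofReal_norm _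
      _ ≤ g x := enorm_integral_le_lintegral_enorm _
  refine (measure_mono hsub).trans ?_
  refine (meas_ge_le_lintegral_div hgm.aemeasurable (by simpa using ht)
    ENNReal.ofReal_ne_top).trans ?_
  rw [ENNReal.ofReal_div_of_pos ht]
  gcongr

theorem tendsto_nullSample {R : ℝ} (hR : 0 < R) {t : ℝ} (ht : 0 < t) :
    Tendsto (fun n => nullSample n {x | t ≤ ‖marginalLikelihoodRatio (altPrior R n) nullPrior x
      - limitRatio R (XiStat x)‖}) atTop (𝓝 0) := by
  rw [ENNReal.tendsto_atTop_zero]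
  intro e he
  obtain ⟨r, hr, hre⟩ : ∃ r : ℝ, 0 < r ∧ ENNReal.ofReal r ≤ e := by
    obtain ⟨r, hr, hre⟩ := ENNReal.lt_iff_exists_nnreal_btwn.1 he
    exact ⟨r, by simpa using hr, by simpa using hre.le⟩
  have hδ : 0 < r * t := by positivity
  obtain ⟨N, hN⟩ := eventually_atTop.1
    ((eventually_forall_secondMoment_lt hR (pow_pos hδ 2)).and (eventually_gt_atTop 0))
  refine ⟨N, fun n hn => (nullSample_le_of_secondMoment hR (hN n hn).2 hδ (hN n hn).1 ht).trans ?_⟩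
  rwa [mul_div_assoc, div_self ht.ne', mul_one]

theorem map_sample_eq_nullSample {Ω : Type*} [MeasurableSpace Ω] {P : Measure Ω}
    {X : ℕ → Ω → ℝ} (hindep : iIndepFun X P) (hlaw : ∀ i, HasLaw (X i) (gaussianReal 0 1) P)
    (n : ℕ) : P.map (fun ω (i : Fin n) => X i ω) = nullSample n := by
  have hi : iIndepFun (fun i : Fin n => X i) P := hindep.precomp Fin.val_injective
  have := hi.isProbabilityMeasure
  have hpi := (iIndepFun_iff_map_fun_eq_pi_map (f := fun i : Fin n => X i)
    fun i => (hlaw i).aemeasurable).1 hi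
  rw [hpi, nullSample]
  simp only [(hlaw _).map_eq]

end HomogeneityTest

end

theorem theorem3 {Ω : Type*} [MeasurableSpace Ω] (P : Measure Ω) [IsProbabilityMeasure P]
    (X : ℕ → Ω → ℝ)
    (hindep : iIndepFun X P)
    (hlaw : ∀ i, HasLaw (X i) (gaussianReal 0 1) P)
    (R₀ : ℝ) (hR₀ : 0 < R₀) :
    TendstoInMeasure P
      (fun (n : ℕ) (ω : Ω) =>
        HomogeneityTest.marginalLikelihoodRatio
            (HomogeneityTest.altPrior R₀ n) HomogeneityTest.nullPrior
            (fun i : Fin n => X i ω)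
          - HomogeneityTest.limitRatio R₀ (HomogeneityTest.XiStat (fun i : Fin n => X i ω)))
      atTop (fun _ => 0) ∧
    StrictMonoOn HomogeneityTest.besselI0 (Set.Ioi 0) := by
  refine ⟨?_, HomogeneityTest.strictMonoOn_besselI0⟩
  rw [tendstoInMeasure_iff_norm]
  intro t ht
  refine tendsto_of_tendsto_of_tendsto_of_le_of_le tendsto_const_nhds
    (HomogeneityTest.tendsto_nullSample hR₀ ht) (fun _ => zero_le) fun n => ?_
  rw [← HomogeneityTest.map_sample_eq_nullSample hindep hlaw n]
  simp only [sub_zero]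
  exact Measure.le_map_apply (aemeasurable_pi_lambda _ fun i : Fin n => (hlaw i).aemeasurable) _
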